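/- Let $A$ be a finite dimensional $C^*$-algebra, let $H$ and $K$ be finite dimensional complex Hilbert spaces, and let $\rho\colon A\to B(K)$ be a faithful (injective) $*$-representation, through which $A$ is regarded as a $C^*$-subalgebra of $B(K)$. Let $t$ denote the transpose map on $B(H)$ with respect to a fixed orthonormal basis of $H$. For a linear operator $v\colon H\to K$ let $\mathrm{Ad}\,v\colon B(K)\to B(H)$ be the map $x\mapsto v^*xv$. A linear map $\varphi\colon A\to B(H)$ is called positive if it carries positive elements to positive elements, and $\varphi$ majorizes $\psi$, written $\varphi\ge\psi$, if $\varphi-\psi$ is positive. It is $k$-positive if $\iota_k\otimes\varphi\colon M_k(A)\to M_k(B(H))$ is positive, completely positive if it is $k$-positive for all $k$, and $k$-co-positive (respectively co-positive) if $t\circ\varphi$ is $k$-positive (respectively completely positive). It is atomic if it is not the sum of a $2$-positive and a $2$-co-positive map. It is extreme if every positive map $\psi$ with $\varphi\ge\psi$ is of the form $\psi=\lambda\varphi$ with $\lambda\ge 0$. It is bi-optimal if $\psi=0$ whenever $\varphi\ge\psi$ and $\psi\colon A\to B(H)$ is completely positive or co-positive. Let $\varphi\colon A\to B(H)$ be a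 positive map which is extreme. Then at least one of the following holds: (i) $\varphi=\mathrm{Ad}\,v\circ\rho$, that is, $\varphi(a)=v^*\rho(a)v$ for all $a\in A$, for some linear $v\colon H\to K$; (ii) $\varphi=t\circ\mathrm{Ad}\,v\circ\rho$, that is, $\varphi(a)=t(v^*\rho(a)v)$ for all $a\in A$, for some linear $v\colon H\to K$; (iii) $\varphi$ is bi-optimal and atomic. -/

import Mathlib

open scoped InnerProductSpace

namespace PosMaps

noncomputable section

section Abstract

variable {A B : Type*} [CStarAlgebra A] [PartialOrder A] [StarOrderedRing A]
  [CStarAlgebra B] [PartialOrder B] [StarOrderedRing B]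

/-- A linear map is positive if it carries positive elements to positive elements. -/
def IsPositive (φ : A →ₗ[ℂ] B) : Prop :=
  ∀ a : A, 0 ≤ a → 0 ≤ φ a

/-- `φ` majorizes `ψ` (that is, `φ ≥ ψ`) if `φ - ψ` is positive. -/
def Majorizes (φ ψ : A →ₗ[ℂ] B) : Prop :=
  IsPositive (φ - ψ)

/-- `φ` is `k`-positive if `ι_k ⊗ φ : M_k(A) → M_k(B)`, which applies `φ` to every entry,
carries positive elements to positive elements. -/
def IsKPositive (k : ℕ) (φ : A →ₗ[ℂ] B) : Prop :=
  ∀ M : CStarMatrix (Fin k) (Fin k) A, 0 ≤ M → 0 ≤ M.map φ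

/-- `φ` is completely positive if it is `k`-positive for all `k`. -/
def IsCompletelyPositive (φ : A →ₗ[ℂ] B) : Prop :=
  ∀ k : ℕ, IsKPositive k φ

/-- `φ` is extreme if every positive map that it majorizes is a nonnegative multiple of it. -/
def IsExtreme (φ : A →ₗ[ℂ] B) : Prop :=
  ∀ ψ : A →ₗ[ℂ] B, IsPositive ψ → Majorizes φ ψ → ∃ c : ℝ, 0 ≤ c ∧ ψ = (c : ℂ) • φ

/-- `φ` is optimal if it majorizes no nonzero completely positive map. -/
def IsOptimal (φ : A →ₗ[ℂ] B) : Prop :=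
  ∀ ψ : A →ₗ[ℂ] B, IsCompletelyPositive ψ → Majorizes φ ψ → ψ = 0

end Abstract

section Transpose

variable {H ι : Type*} [NormedAddCommGroup H] [InnerProductSpace ℂ H]
  [FiniteDimensional ℂ H] [CompleteSpace H] [Fintype ι] [DecidableEq ι]

/-- The transpose map on `B(H)` with respect to the orthonormal basis `b`. -/
def transpose (b : OrthonormalBasis ι ℂ H) : (H →L[ℂ] H) →ₗ[ℂ] (H →L[ℂ] H) where
  toFun x := LinearMap.toContinuousLinearMap
    (Matrix.toLin b.toBasis b.toBasis
      (LinearMap.toMatrix b.toBasis b.toBasis (x : H →ₗ[ℂ] H)).transpose)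
  map_add' x y := by simp
  map_smul' c x := by simp

variable {A : Type*} [CStarAlgebra A] [PartialOrder A] [StarOrderedRing A]

/-- `φ` is `k`-co-positive if `t ∘ φ` is `k`-positive. -/
def IsKCoPositive (b : OrthonormalBasis ι ℂ H) (k : ℕ) (φ : A →ₗ[ℂ] (H →L[ℂ] H)) : Prop :=
  IsKPositive k (transpose b ∘ₗ φ)

/-- `φ` is co-positive if `t ∘ φ` is completely positive. -/
def IsCoPositive (b : OrthonormalBasis ι ℂ H) (φ : A →ₗ[ℂ] (H →L[ℂ] H)) : Prop :=
  IsCompletelyPositive (transpose b ∘ₗ φ)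

/-- `φ` is `k`-decomposable if it is the sum of a `k`-positive and a `k`-co-positive map. -/
def IsKDecomposable (b : OrthonormalBasis ι ℂ H) (k : ℕ) (φ : A →ₗ[ℂ] (H →L[ℂ] H)) : Prop :=
  ∃ φ₁ φ₂ : A →ₗ[ℂ] (H →L[ℂ] H), IsKPositive k φ₁ ∧ IsKCoPositive b k φ₂ ∧ φ = φ₁ + φ₂

/-- `φ` is atomic if it is not `2`-decomposable. -/
def IsAtomic (b : OrthonormalBasis ι ℂ H) (φ : A →ₗ[ℂ] (H →L[ℂ] H)) : Prop :=
  ¬ IsKDecomposable b 2 φ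

/-- `φ` is co-optimal if it majorizes no nonzero co-positive map. -/
def IsCoOptimal (b : OrthonormalBasis ι ℂ H) (φ : A →ₗ[ℂ] (H →L[ℂ] H)) : Prop :=
  ∀ ψ : A →ₗ[ℂ] (H →L[ℂ] H), IsCoPositive b ψ → Majorizes φ ψ → ψ = 0

/-- `φ` is bi-optimal if it is both optimal and co-optimal. -/
def IsBiOptimal (b : OrthonormalBasis ι ℂ H) (φ : A →ₗ[ℂ] (H →L[ℂ] H)) : Prop :=
  IsOptimal φ ∧ IsCoOptimal b φ

end Transpose

section Ad

variable {H K : Type*} [NormedAddCommGroup H] [InnerProductSpace ℂ H] [CompleteSpace H]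
  [NormedAddCommGroup K] [InnerProductSpace ℂ K] [CompleteSpace K]

/-- For `v : H → K`, the map `Ad v : B(K) → B(H)`, `x ↦ v* x v`. -/
def Ad (v : H →L[ℂ] K) : (K →L[ℂ] K) →ₗ[ℂ] (H →L[ℂ] H) where
  toFun x := ContinuousLinearMap.adjoint v ∘L x ∘L v
  map_add' x y := by simp
  map_smul' c x := by simp

end Ad

end

end PosMaps

/-!
Suppose `φ ≠ 0` is `2`-positive and vanishes on `ker ρ`. Let `J` be a left ideal minimal among those
on which `φ` does not vanish, and pick `b ∈ J` and a vector `k` with `φ b ≠ 0` and `ρ b k ≠ 0`. By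
minimality `φ` vanishes on the left ideal `{a ∈ J | ρ a k = 0}`, so for every vector `x` the map
`ρ a k ↦ φ a x` is well defined on the `ρ`-invariant subspace `ρ J k`. The Cauchy–Schwarz inequality
for `2`-positive maps shows that its adjoint `v : H → K` satisfies `Ad v ∘ ρ ≤ c φ` for some `c`. An
extreme `2`-positive map is therefore of the form `Ad v ∘ ρ`, and the transpose turns this into the
statement for `2`-co-positive maps. If `φ` is extreme and majorizes a nonzero `2`-positive map, it
is a multiple of that map; so an extreme `φ` which is neither `2`-positive nor `2`-co-positive is
bi-optimal and atomic.
-/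

namespace PosMaps

open scoped ComplexOrder

section LeftIdeals

theorem exists_submodule_forall_mem_inf_eq_zero {R M N ι : Type*} [Semiring R] [AddCommMonoid M]
    [Module R M] [IsArtinian R M] [Zero N] {f : M → N} (hf : ∃ m, f m ≠ 0)
    (I : ι → Submodule R M) (hI : ∀ m, (∀ i, m ∈ I i) → f m = 0) :
    ∃ J : Submodule R M, (∃ m ∈ J, f m ≠ 0) ∧ ∃ i, ∀ m ∈ J ⊓ I i, f m = 0 := by
  obtain ⟨m₀, hm₀⟩ := hf
  obtain ⟨J, hJ⟩ := exists_minimal_of_wellFoundedLT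
    (fun J : Submodule R M => ∃ m ∈ J, f m ≠ 0) ⟨⊤, m₀, Submodule.mem_top, hm₀⟩
  obtain ⟨b, hbJ, hfb⟩ := hJ.prop
  obtain ⟨i, hbi⟩ : ∃ i, b ∉ I i := by
    by_contra! h
    exact hfb (hI b h)
  have hlt : J ⊓ I i < J := inf_lt_left.2 fun hle => hbi (hle hbJ)
  refine ⟨J, hJ.prop, i, fun m hm => ?_⟩
  by_contra hfm
  exact hJ.not_prop_of_lt hlt ⟨m, hm, hfm⟩

variable {𝕜 A K V : Type*} [Field 𝕜] [Ring A] [Algebra 𝕜 A] [AddCommGroup K] [Module 𝕜 K]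
  [AddCommGroup V] [Module 𝕜 V]

/-- The left ideal `{a | ρ a k = 0}` of a vector `k` in a representation `ρ`, along which a map
defined on vectors `ρ a k` has to be checked to be well defined. The representation need not be
unital. -/
def leftAnnihilator (ρ : A →ₙₐ[𝕜] Module.End 𝕜 K) (k : K) : Ideal A where
  carrier := {a | ρ a k = 0}
  zero_mem' := by simp
  add_mem' {a b} (ha : ρ a k = 0) (hb : ρ b k = 0) := by simp [ha, hb]
  smul_mem' a b (hb : ρ b k = 0) := by simp [hb]

theorem mem_leftAnnihilator {ρ : A →ₙₐ[𝕜] Module.End 𝕜 K} {k : K} {a : A} :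
    a ∈ leftAnnihilator ρ k ↔ ρ a k = 0 :=
  Iff.rfl

theorem exists_finiteDimensional_section [FiniteDimensional 𝕜 A] (ρ : A →ₙₐ[𝕜] Module.End 𝕜 K)
    {φ : A →ₗ[𝕜] V} (hφ : φ ≠ 0) (hρ : ∀ a, ρ a = 0 → φ a = 0) :
    ∃ (E : Submodule 𝕜 K) (_ : FiniteDimensional 𝕜 E) (r : E →ₗ[𝕜] A), (∃ w, φ (r w) ≠ 0) ∧
      ∀ a (w : E), ∃ w' : E, (w' : K) = ρ a w ∧ φ (r w') = φ (a * r w) := by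
  have : IsArtinianRing A := IsArtinianRing.of_finite 𝕜 A
  obtain ⟨J, ⟨b, hbJ, hφb⟩, k, hJk⟩ := exists_submodule_forall_mem_inf_eq_zero
    (DFunLike.ne_iff.1 hφ) (leftAnnihilator ρ) fun a ha => hρ a (LinearMap.ext ha)
  let R : A →ₗ[𝕜] K := LinearMap.applyₗ k ∘ₗ (ρ : A →ₗ[𝕜] Module.End 𝕜 K)
  let Q := R.submoduleMap (J.restrictScalars 𝕜)
  obtain ⟨q, hq⟩ := Q.exists_rightInverse_of_surjective
    (LinearMap.range_eq_top.2 (R.submoduleMap_surjective _))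
  have hRq (w) : ρ (q w) k = w := congrArg Subtype.val (LinearMap.congr_fun hq w)
  have hφq (a : J.restrictScalars 𝕜) : φ (q (Q a)) = φ a := by
    rw [← sub_eq_zero, ← map_sub]
    refine hJk _ ⟨J.sub_mem (q (Q a)).2 a.2, ?_⟩
    rw [SetLike.mem_coe, mem_leftAnnihilator, map_sub, LinearMap.sub_apply, hRq, sub_eq_zero]
    rfl
  refine ⟨_, inferInstance, Submodule.subtype _ ∘ₗ q, ⟨Q ⟨b, hbJ⟩, (hφq _).trans_ne hφb⟩,
    fun a w => ⟨Q ⟨a * q w, J.smul_mem a (q w).2⟩, ?_, hφq _⟩⟩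
  calc ρ (a * q w) k = ρ a (ρ (q w) k) := by rw [map_mul, Module.End.mul_apply]
    _ = ρ a w := by rw [hRq]

end LeftIdeals

section Order

variable {A B : Type*} [CStarAlgebra A] [PartialOrder A] [CStarAlgebra B] [PartialOrder B]

theorem IsExtreme.exists_eq_smul {φ ψ : A →ₗ[ℂ] B} (hφ : IsExtreme φ) (hψ : IsPositive ψ)
    (h : Majorizes φ ψ) (h0 : ψ ≠ 0) : ∃ c : ℝ, 0 ≤ c ∧ φ = (c : ℂ) • ψ := by
  obtain ⟨c, hc, rfl⟩ := hφ ψ hψ h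
  have hc0 : (c : ℂ) ≠ 0 := left_ne_zero_of_smul h0
  refine ⟨c⁻¹, inv_nonneg.2 hc, ?_⟩
  rw [Complex.ofReal_inv, inv_smul_smul₀ hc0]

variable [StarOrderedRing A] [StarOrderedRing B]

theorem IsKPositive.smul {k : ℕ} {φ : A →ₗ[ℂ] B} (hφ : IsKPositive k φ) {c : ℝ} (hc : 0 ≤ c) :
    IsKPositive k ((c : ℂ) • φ) := by
  intro M hM
  have hmap : M.map ((c : ℂ) • φ) = c • M.map φ := by
    ext i j
    simp [CStarMatrix.map_apply]
  exact hmap ▸ smul_nonneg hc (hφ M hM)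

theorem exists_eq_star_mul_self_of_nonneg {a : A} (ha : 0 ≤ a) : ∃ s : A, a = star s * s :=
  CStarAlgebra.nonneg_iff_eq_star_mul_self.1 ha

theorem IsKPositive.exists_map_star_mul_eq_sum {k : ℕ} [NeZero k] {φ : A →ₗ[ℂ] B}
    (hφ : IsKPositive k φ) (a : Fin k → A) :
    ∃ N : Fin k → Fin k → B, ∀ i j, φ (star (a i) * a j) = ∑ l, star (N l i) * N l j := by
  -- `star S * S` has entries `star (a i) * a j` when the only nonzero row of `S` is `a`.
  let S : CStarMatrix (Fin k) (Fin k) A := CStarMatrix.ofMatrix fun i j => if i = 0 then a j else 0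
  have hS (i j) : (star S * S) i j = star (a i) * a j := by
    have hSij (i j) : S i j = if i = 0 then a j else 0 := rfl
    simp [CStarMatrix.mul_apply, CStarMatrix.star_apply, hSij]
  obtain ⟨N, hN⟩ := exists_eq_star_mul_self_of_nonneg (hφ _ (star_mul_self_nonneg S))
  refine ⟨N, fun i j => ?_⟩
  have hij := congrFun (congrFun hN i) j
  rwa [CStarMatrix.map_apply, hS, CStarMatrix.mul_apply] at hij

theorem IsKPositive.isPositive {k : ℕ} [NeZero k] {φ : A →ₗ[ℂ] B} (hφ : IsKPositive k φ) :
    IsPositive φ := by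
  intro a ha
  obtain ⟨s, rfl⟩ := exists_eq_star_mul_self_of_nonneg ha
  obtain ⟨N, hN⟩ := hφ.exists_map_star_mul_eq_sum fun _ => s
  rw [hN 0 0]
  exact Finset.sum_nonneg fun l _ => star_mul_self_nonneg _

theorem IsExtreme.isKPositive_of_majorizes {k : ℕ} [NeZero k] {φ ψ : A →ₗ[ℂ] B}
    (hφ : IsExtreme φ) (hψ : IsKPositive k ψ) (h : Majorizes φ ψ) (h0 : ψ ≠ 0) :
    IsKPositive k φ := by
  obtain ⟨c, hc, rfl⟩ := hφ.exists_eq_smul hψ.isPositive h h0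
  exact hψ.smul hc

theorem IsExtreme.isOptimal {k : ℕ} [NeZero k] {φ : A →ₗ[ℂ] B} (hφ : IsExtreme φ)
    (hk : ¬ IsKPositive k φ) : IsOptimal φ := by
  intro ψ hψ h
  by_contra h0
  exact hk (hφ.isKPositive_of_majorizes (hψ k) h h0)

end Order

section CauchySchwarz

theorem inner_star_mul_apply {H : Type*} [NormedAddCommGroup H] [InnerProductSpace ℂ H]
    [CompleteSpace H] (S T : H →L[ℂ] H) (x y : H) :
    ⟪x, (star S * T) y⟫_ℂ = ⟪S x, T y⟫_ℂ :=
  ContinuousLinearMap.adjoint_inner_right S x (T y)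

variable {A : Type*} [CStarAlgebra A] [PartialOrder A]
  {H : Type*} [NormedAddCommGroup H] [InnerProductSpace ℂ H] [CompleteSpace H]

theorem IsPositive.re_inner_nonneg {φ : A →ₗ[ℂ] (H →L[ℂ] H)} (hφ : IsPositive φ) {a : A}
    (ha : 0 ≤ a) (y : H) : 0 ≤ (⟪y, φ a y⟫_ℂ).re :=
  ((φ a).nonneg_iff_isPositive.1 (hφ a ha)).re_inner_nonneg_right y

theorem IsPositive.majorizes_of_re_inner_le {φ ψ : A →ₗ[ℂ] (H →L[ℂ] H)} (hφ : IsPositive φ)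
    (hψ : IsPositive ψ) (h : ∀ a, 0 ≤ a → ∀ y, (⟪y, ψ a y⟫_ℂ).re ≤ (⟪y, φ a y⟫_ℂ).re) :
    Majorizes φ ψ := by
  intro a ha
  refine (ContinuousLinearMap.nonneg_iff_isPositive _).2 <| ContinuousLinearMap.isPositive_def'.2
    ⟨(IsSelfAdjoint.of_nonneg (hφ a ha)).sub (IsSelfAdjoint.of_nonneg (hψ a ha)), fun y => ?_⟩
  rw [ContinuousLinearMap.reApplyInnerSelf_apply, inner_re_symm, LinearMap.sub_apply, sub_apply,
    inner_sub_right, map_sub]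
  exact sub_nonneg.2 (h a ha y)

variable [StarOrderedRing A]

theorem IsKPositive.norm_inner_map_star_mul_sq_le {φ : A →ₗ[ℂ] (H →L[ℂ] H)}
    (hφ : IsKPositive 2 φ) (a b : A) (x y : H) :
    ‖⟪y, φ (star a * b) x⟫_ℂ‖ ^ 2 ≤
      (⟪y, φ (star a * a) y⟫_ℂ).re * (⟪x, φ (star b * b) x⟫_ℂ).re := by
  obtain ⟨N, hN⟩ := hφ.exists_map_star_mul_eq_sum ![a, b]
  have hinner (i j) (u w : H) :
      ⟪u, φ (star (![a, b] i) * ![a, b] j) w⟫_ℂ = ∑ l, ⟪N l i u, N l j w⟫_ℂ := by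
    rw [hN, sum_apply, inner_sum]
    exact Finset.sum_congr rfl fun l _ => inner_star_mul_apply _ _ _ _
  have hre (i) (u : H) :
      (⟪u, φ (star (![a, b] i) * ![a, b] i) u⟫_ℂ).re = ∑ l, ‖N l i u‖ ^ 2 := by
    rw [hinner, Complex.re_sum]
    exact Finset.sum_congr rfl fun l _ => inner_self_eq_norm_sq (𝕜 := ℂ) _
  calc ‖⟪y, φ (star a * b) x⟫_ℂ‖ ^ 2 = ‖∑ l, ⟪N l 0 y, N l 1 x⟫_ℂ‖ ^ 2 :=
        congrArg (‖·‖ ^ 2) (hinner 0 1 y x)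
    _ ≤ (∑ l, ‖N l 0 y‖ * ‖N l 1 x‖) ^ 2 := by
        gcongr
        exact norm_sum_le_of_le _ fun l _ => norm_inner_le_norm _ _
    _ ≤ (∑ l, ‖N l 0 y‖ ^ 2) * ∑ l, ‖N l 1 x‖ ^ 2 := Finset.sum_mul_sq_le_sq_mul_sq _ _ _
    _ = (⟪y, φ (star a * a) y⟫_ℂ).re * (⟪x, φ (star b * b) x⟫_ℂ).re := by
        rw [← hre 0 y, ← hre 1 x]
        rfl

theorem IsKPositive.norm_sq_le_of_inner_eq {φ : A →ₗ[ℂ] (H →L[ℂ] H)} (hφ : IsKPositive 2 φ)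
    {K : Type*} [NormedAddCommGroup K] [InnerProductSpace ℂ K] {a b : A} {x y : H} {u : K}
    {c : ℝ} (hc : 0 ≤ c)
    (hu : ⟪u, u⟫_ℂ = ⟪y, φ (star a * b) x⟫_ℂ) (hb : (⟪x, φ (star b * b) x⟫_ℂ).re ≤ c * ‖u‖ ^ 2) :
    ‖u‖ ^ 2 ≤ c * (⟪y, φ (star a * a) y⟫_ℂ).re := by
  have ha := hφ.isPositive.re_inner_nonneg (star_mul_self_nonneg a) y
  rcases (sq_nonneg ‖u‖).eq_or_lt with h0 | hpos
  · exact h0 ▸ mul_nonneg hc ha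
  refine le_of_mul_le_mul_right ?_ hpos
  calc ‖u‖ ^ 2 * ‖u‖ ^ 2 = ‖⟪y, φ (star a * b) x⟫_ℂ‖ ^ 2 := by
        rw [← hu, inner_self_eq_norm_sq_to_K]
        simp [sq]
    _ ≤ (⟪y, φ (star a * a) y⟫_ℂ).re * (⟪x, φ (star b * b) x⟫_ℂ).re :=
        hφ.norm_inner_map_star_mul_sq_le a b x y
    _ ≤ (⟪y, φ (star a * a) y⟫_ℂ).re * (c * ‖u‖ ^ 2) := by gcongr
    _ = c * (⟪y, φ (star a * a) y⟫_ℂ).re * ‖u‖ ^ 2 := by ring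

end CauchySchwarz

section AdComp

variable {A : Type*} [CStarAlgebra A]
  {H : Type*} [NormedAddCommGroup H] [InnerProductSpace ℂ H]
  {K : Type*} [NormedAddCommGroup K] [InnerProductSpace ℂ K] [CompleteSpace K]

theorem exists_re_inner_map_star_mul_self_le [FiniteDimensional ℂ A] {E : Type*}
    [NormedAddCommGroup E] [NormedSpace ℂ E] [FiniteDimensional ℂ E] (φ : A →ₗ[ℂ] (H →L[ℂ] H))
    (r : E →ₗ[ℂ] A) (x : H) :
    ∃ c : ℝ, 0 < c ∧ ∀ w, (⟪x, φ (star (r w) * r w) x⟫_ℂ).re ≤ c * ‖w‖ ^ 2 := by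
  let Φ := LinearMap.toContinuousLinearMap φ
  let r' := LinearMap.toContinuousLinearMap r
  refine ⟨‖Φ‖ * ‖r'‖ ^ 2 * ‖x‖ ^ 2 + 1, by positivity, fun w => ?_⟩
  calc (⟪x, Φ (star (r' w) * r' w) x⟫_ℂ).re
      ≤ ‖x‖ * ‖Φ (star (r' w) * r' w) x‖ := re_inner_le_norm (𝕜 := ℂ) _ _
    _ ≤ ‖x‖ * (‖Φ‖ * (‖r' w‖ * ‖r' w‖) * ‖x‖) := by
        rw [← CStarRing.norm_star_mul_self]
        gcongr
        exact (ContinuousLinearMap.le_opNorm _ _).trans (by gcongr; exact Φ.le_opNorm _)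
    _ ≤ ‖x‖ * (‖Φ‖ * ((‖r'‖ * ‖w‖) * (‖r'‖ * ‖w‖)) * ‖x‖) := by
        gcongr <;> exact r'.le_opNorm w
    _ ≤ (‖Φ‖ * ‖r'‖ ^ 2 * ‖x‖ ^ 2 + 1) * ‖w‖ ^ 2 := by linarith [sq_nonneg ‖w‖]

variable [CompleteSpace H]

/-- The map `Ad v ∘ ρ` on `A`, the form to which extreme `2`-positive maps are to be reduced. -/
noncomputable def adComp (ρ : A →⋆ₙₐ[ℂ] (K →L[ℂ] K)) (v : H →L[ℂ] K) : A →ₗ[ℂ] (H →L[ℂ] H) :=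
  Ad v ∘ₗ (ρ : A →ₗ[ℂ] (K →L[ℂ] K))

theorem adComp_smul (ρ : A →⋆ₙₐ[ℂ] (K →L[ℂ] K)) (c : ℝ) (v : H →L[ℂ] K) :
    adComp ρ ((c : ℂ) • v) = ((c ^ 2 : ℝ) : ℂ) • adComp ρ v := by
  ext a y
  change ContinuousLinearMap.adjoint ((c : ℂ) • v) (ρ a ((c : ℂ) • v y)) =
    ((c ^ 2 : ℝ) : ℂ) • ContinuousLinearMap.adjoint v (ρ a (v y))
  rw [map_smulₛₗ, map_smul, Complex.conj_ofReal, smul_apply, map_smul, smul_smul,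
    ← Complex.ofReal_mul, ← sq]

theorem inner_adComp_star_mul (ρ : A →⋆ₙₐ[ℂ] (K →L[ℂ] K)) (v : H →L[ℂ] K) (a b : A) (x y : H) :
    ⟪x, adComp ρ v (star a * b) y⟫_ℂ = ⟪ρ a (v x), ρ b (v y)⟫_ℂ := by
  calc ⟪x, adComp ρ v (star a * b) y⟫_ℂ = ⟪v x, ρ (star a * b) (v y)⟫_ℂ :=
        ContinuousLinearMap.adjoint_inner_right v _ _
    _ = ⟪ρ a (v x), ρ b (v y)⟫_ℂ := by rw [map_mul, map_star, inner_star_mul_apply]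

theorem exists_inner_map_apply_eq {ρ : A →⋆ₙₐ[ℂ] (K →L[ℂ] K)} {φ : A →ₗ[ℂ] (H →L[ℂ] H)}
    {E : Submodule ℂ K} [FiniteDimensional ℂ E] {r : E →ₗ[ℂ] A}
    (hr : ∀ a (w : E), ∃ w' : E, (w' : K) = ρ a w ∧ φ (r w') = φ (a * r w)) (x : H) :
    ∃ v : H →L[ℂ] K, ∀ a y, ρ a (v y) ∈ E ∧
      ∀ w : E, ⟪ρ a (v y), (w : K)⟫_ℂ = ⟪y, φ (star a * r w) x⟫_ℂ := by
  let T : E →L[ℂ] H := LinearMap.toContinuousLinearMap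
    (LinearMap.applyₗ x ∘ₗ ContinuousLinearMap.coeLM ℂ ∘ₗ φ ∘ₗ r)
  let u := ContinuousLinearMap.adjoint T
  refine ⟨E.subtypeL ∘L u, fun a y => ⟨?_, fun w => ?_⟩⟩
  · obtain ⟨w', hw', -⟩ := hr a (u y)
    exact hw' ▸ w'.2
  · obtain ⟨w', hw', hφw'⟩ := hr (star a) w
    calc ⟪ρ a (u y), (w : K)⟫_ℂ = ⟪(u y : K), ρ (star a) w⟫_ℂ := by
          rw [map_star]
          exact (ContinuousLinearMap.adjoint_inner_right (ρ a) _ _).symm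
      _ = ⟪u y, w'⟫_ℂ := by rw [← hw', Submodule.coe_inner]
      _ = ⟪y, φ (r w') x⟫_ℂ := ContinuousLinearMap.adjoint_inner_left T w' y
      _ = ⟪y, φ (star a * r w) x⟫_ℂ := by rw [hφw']

variable [PartialOrder A] [StarOrderedRing A]

theorem isPositive_adComp (ρ : A →⋆ₙₐ[ℂ] (K →L[ℂ] K)) (v : H →L[ℂ] K) :
    IsPositive (adComp ρ v) := by
  intro a ha
  have hρa : (ρ a).IsPositive := (ρ a).nonneg_iff_isPositive.1 (map_nonneg ρ ha)
  exact (ContinuousLinearMap.nonneg_iff_isPositive _).2 (hρa.adjoint_conj v)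

theorem IsPositive.majorizes_adComp {φ : A →ₗ[ℂ] (H →L[ℂ] H)} (hφ : IsPositive φ)
    {ρ : A →⋆ₙₐ[ℂ] (K →L[ℂ] K)} {v : H →L[ℂ] K}
    (h : ∀ a y, ‖ρ a (v y)‖ ^ 2 ≤ (⟪y, φ (star a * a) y⟫_ℂ).re) :
    Majorizes φ (adComp ρ v) := by
  refine hφ.majorizes_of_re_inner_le (isPositive_adComp ρ v) fun a ha y => ?_
  obtain ⟨s, rfl⟩ := exists_eq_star_mul_self_of_nonneg ha
  rw [inner_adComp_star_mul]
  exact (inner_self_eq_norm_sq (𝕜 := ℂ) _).trans_le (h s y)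

theorem IsPositive.exists_majorizes_adComp_of_norm_sq_le {φ : A →ₗ[ℂ] (H →L[ℂ] H)}
    (hφ : IsPositive φ) {ρ : A →⋆ₙₐ[ℂ] (K →L[ℂ] K)} {v : H →L[ℂ] K} {c : ℝ} (hc : 0 < c)
    (h : ∀ a y, ‖ρ a (v y)‖ ^ 2 ≤ c * (⟪y, φ (star a * a) y⟫_ℂ).re) (hv : adComp ρ v ≠ 0) :
    ∃ v' : H →L[ℂ] K, adComp ρ v' ≠ 0 ∧ Majorizes φ (adComp ρ v') := by
  have hsq : (√c)⁻¹ ^ 2 = c⁻¹ := by rw [inv_pow, Real.sq_sqrt hc.le]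
  refine ⟨(((√c)⁻¹ : ℝ) : ℂ) • v, ?_, hφ.majorizes_adComp fun a y => ?_⟩
  · rw [adComp_smul, hsq]
    exact smul_ne_zero (Complex.ofReal_ne_zero.2 (inv_ne_zero hc.ne')) hv
  · rw [smul_apply, map_smul, norm_smul, mul_pow, Complex.norm_real, Real.norm_eq_abs, sq_abs, hsq]
    exact (inv_mul_le_iff₀ hc).2 (h a y)

theorem IsKPositive.exists_majorizes_adComp [FiniteDimensional ℂ A] {φ : A →ₗ[ℂ] (H →L[ℂ] H)}
    (hφ : IsKPositive 2 φ) (h0 : φ ≠ 0) (ρ : A →⋆ₙₐ[ℂ] (K →L[ℂ] K))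
    (hρ : ∀ a, ρ a = 0 → φ a = 0) :
    ∃ v : H →L[ℂ] K, adComp ρ v ≠ 0 ∧ Majorizes φ (adComp ρ v) := by
  let ρ' : A →ₙₐ[ℂ] Module.End ℂ K :=
    { toFun a := (ρ a : K →ₗ[ℂ] K)
      map_zero' := by simp
      map_add' a b := by simp
      map_smul' c a := by simp
      map_mul' a b := by rw [map_mul]; rfl }
  obtain ⟨E, _, r, ⟨w, hw⟩, hr⟩ := exists_finiteDimensional_section ρ' h0
    fun a ha => hρ a (ContinuousLinearMap.ext (LinearMap.congr_fun ha))
  obtain ⟨x, hx⟩ := DFunLike.ne_iff.1 hw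
  obtain ⟨v, hv⟩ := exists_inner_map_apply_eq (ρ := ρ) hr x
  obtain ⟨c, hc, hrc⟩ := exists_re_inner_map_star_mul_self_le φ r x
  have hbound (a y) : ‖ρ a (v y)‖ ^ 2 ≤ c * (⟪y, φ (star a * a) y⟫_ℂ).re :=
    hφ.norm_sq_le_of_inner_eq hc.le ((hv a y).2 ⟨_, (hv a y).1⟩) (hrc _)
  have hne : adComp ρ v ≠ 0 := by
    intro hzero
    have hρv (y) : ρ 1 (v y) = 0 := by
      rw [← inner_self_eq_zero (𝕜 := ℂ), ← inner_adComp_star_mul, hzero]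
      simp
    have hinner := (hv 1 (φ (r w) x)).2 w
    rw [hρv, inner_zero_left, star_one, one_mul, eq_comm, inner_self_eq_zero] at hinner
    exact hx hinner
  exact hφ.isPositive.exists_majorizes_adComp_of_norm_sq_le hc hbound hne

theorem IsExtreme.exists_eq_adComp [FiniteDimensional ℂ A] {φ : A →ₗ[ℂ] (H →L[ℂ] H)}
    (hext : IsExtreme φ) (hφ : IsKPositive 2 φ) (ρ : A →⋆ₙₐ[ℂ] (K →L[ℂ] K))
    (hρ : ∀ a, ρ a = 0 → φ a = 0) : ∃ v : H →L[ℂ] K, φ = adComp ρ v := by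
  rcases eq_or_ne φ 0 with rfl | h0
  · exact ⟨0, by ext; simp [adComp, Ad]⟩
  obtain ⟨v, hv0, hmaj⟩ := hφ.exists_majorizes_adComp h0 ρ hρ
  obtain ⟨c, hc, hφv⟩ := hext.exists_eq_smul (isPositive_adComp ρ v) hmaj hv0
  refine ⟨((√c : ℝ) : ℂ) • v, ?_⟩
  rw [adComp_smul, Real.sq_sqrt hc, hφv]

end AdComp

section Transpose

variable {H ι : Type*} [NormedAddCommGroup H] [InnerProductSpace ℂ H]
  [FiniteDimensional ℂ H] [Fintype ι] [DecidableEq ι] (b : OrthonormalBasis ι ℂ H)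

theorem transpose_transpose (x : H →L[ℂ] H) : transpose b (transpose b x) = x := by
  ext y
  simp [transpose]

theorem transpose_nonneg {x : H →L[ℂ] H} (hx : 0 ≤ x) : 0 ≤ transpose b x := by
  rw [ContinuousLinearMap.nonneg_iff_isPositive, ← ContinuousLinearMap.isPositive_toLinearMap_iff,
    ← LinearMap.posSemidef_toMatrix_iff b] at hx ⊢
  simpa [transpose] using hx.transpose

theorem transpose_comp_transpose_comp {M : Type*} [AddCommMonoid M] [Module ℂ M]
    (φ : M →ₗ[ℂ] (H →L[ℂ] H)) : transpose b ∘ₗ transpose b ∘ₗ φ = φ :=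
  LinearMap.ext fun a => transpose_transpose b (φ a)

variable [CompleteSpace H] {A : Type*} [CStarAlgebra A] [PartialOrder A]
  {φ ψ : A →ₗ[ℂ] (H →L[ℂ] H)}

theorem IsPositive.transpose_comp (hφ : IsPositive φ) : IsPositive (transpose b ∘ₗ φ) :=
  fun a ha => transpose_nonneg b (hφ a ha)

theorem Majorizes.transpose_comp (h : Majorizes φ ψ) :
    Majorizes (transpose b ∘ₗ φ) (transpose b ∘ₗ ψ) := by
  rw [Majorizes, ← LinearMap.comp_sub]
  exact IsPositive.transpose_comp b h

theorem IsExtreme.transpose_comp (hφ : IsExtreme φ) : IsExtreme (transpose b ∘ₗ φ) := by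
  intro ψ hψ h
  have hmaj := h.transpose_comp b
  rw [transpose_comp_transpose_comp] at hmaj
  obtain ⟨c, hc, hψφ⟩ := hφ _ (hψ.transpose_comp b) hmaj
  refine ⟨c, hc, ?_⟩
  rw [← LinearMap.comp_smul, ← hψφ, transpose_comp_transpose_comp]

variable [StarOrderedRing A]

theorem IsKCoPositive.isPositive {k : ℕ} [NeZero k] (hφ : IsKCoPositive b k φ) :
    IsPositive φ := by
  rw [← transpose_comp_transpose_comp b φ]
  exact (IsKPositive.isPositive hφ).transpose_comp b

theorem IsOptimal.isCoOptimal (h : IsOptimal (transpose b ∘ₗ φ)) : IsCoOptimal b φ := by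
  intro ψ hψ hmaj
  rw [← transpose_comp_transpose_comp b ψ, h _ hψ (hmaj.transpose_comp b), LinearMap.comp_zero]

theorem IsExtreme.isBiOptimal {k : ℕ} [NeZero k] (hφ : IsExtreme φ) (hk : ¬ IsKPositive k φ)
    (hk' : ¬ IsKCoPositive b k φ) : IsBiOptimal b φ :=
  ⟨hφ.isOptimal hk, ((hφ.transpose_comp b).isOptimal hk').isCoOptimal⟩

theorem IsExtreme.isKPositive_or_isKCoPositive {k : ℕ} [NeZero k] (hφ : IsExtreme φ)
    (h : IsKDecomposable b k φ) : IsKPositive k φ ∨ IsKCoPositive b k φ := by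
  obtain ⟨φ₁, φ₂, hφ₁, hφ₂, rfl⟩ := h
  rcases eq_or_ne φ₁ 0 with rfl | h0
  · exact .inr (by rwa [zero_add])
  · refine .inl (hφ.isKPositive_of_majorizes hφ₁ ?_ h0)
    rw [Majorizes, add_sub_cancel_left]
    exact hφ₂.isPositive

end Transpose

end PosMaps

theorem corollary5_general
    {A : Type*} [CStarAlgebra A] [PartialOrder A] [StarOrderedRing A] [FiniteDimensional ℂ A]
    {H : Type*} [NormedAddCommGroup H] [InnerProductSpace ℂ H]
    [FiniteDimensional ℂ H] [CompleteSpace H]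
    {ι : Type*} [Fintype ι] [DecidableEq ι] (b : OrthonormalBasis ι ℂ H)
    {K : Type*} [NormedAddCommGroup K] [InnerProductSpace ℂ K] [CompleteSpace K]
    (ρ : A →⋆ₙₐ[ℂ] (K →L[ℂ] K)) (φ : A →ₗ[ℂ] (H →L[ℂ] H)) (hρ : ∀ a, ρ a = 0 → φ a = 0)
    (hext : PosMaps.IsExtreme φ) :
    (∃ v : H →L[ℂ] K, ∀ a : A, φ a = PosMaps.Ad v (ρ a)) ∨
    (∃ v : H →L[ℂ] K, ∀ a : A, φ a = PosMaps.transpose b (PosMaps.Ad v (ρ a))) ∨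
    (PosMaps.IsBiOptimal b φ ∧ PosMaps.IsAtomic b φ) := by
  by_cases hpos : PosMaps.IsKPositive 2 φ
  · obtain ⟨v, rfl⟩ := hext.exists_eq_adComp hpos ρ hρ
    exact .inl ⟨v, fun _ => rfl⟩
  by_cases hcopos : PosMaps.IsKCoPositive b 2 φ
  · obtain ⟨v, hv⟩ := (hext.transpose_comp b).exists_eq_adComp hcopos ρ
      fun a ha => by rw [LinearMap.comp_apply, hρ a ha, map_zero]
    refine .inr (.inl ⟨v, fun a => ?_⟩)
    rw [← PosMaps.transpose_transpose b (φ a)]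
    exact congrArg _ (LinearMap.congr_fun hv a)
  · exact .inr (.inr ⟨hext.isBiOptimal b hpos hcopos,
      fun hdec => (hext.isKPositive_or_isKCoPositive b hdec).elim hpos hcopos⟩)

theorem corollary5
    {A : Type*} [CStarAlgebra A] [PartialOrder A] [StarOrderedRing A] [FiniteDimensional ℂ A]
    {H : Type*} [NormedAddCommGroup H] [InnerProductSpace ℂ H]
    [FiniteDimensional ℂ H] [CompleteSpace H]
    {ι : Type*} [Fintype ι] [DecidableEq ι] (b : OrthonormalBasis ι ℂ H)
    {K : Type*} [NormedAddCommGroup K] [InnerProductSpace ℂ K]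
    [FiniteDimensional ℂ K] [CompleteSpace K]
    (ρ : A →⋆ₙₐ[ℂ] (K →L[ℂ] K)) (hρ : Function.Injective ρ)
    (φ : A →ₗ[ℂ] (H →L[ℂ] H)) (hpos : PosMaps.IsPositive φ) (hext : PosMaps.IsExtreme φ) :
    (∃ v : H →L[ℂ] K, ∀ a : A, φ a = PosMaps.Ad v (ρ a)) ∨
    (∃ v : H →L[ℂ] K, ∀ a : A, φ a = PosMaps.transpose b (PosMaps.Ad v (ρ a))) ∨
    (PosMaps.IsBiOptimal b φ ∧ PosMaps.IsAtomic b φ) :=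
  corollary5_general b ρ φ (fun a ha => by rw [(map_eq_zero_iff ρ hρ).1 ha, map_zero]) hext
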